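/- For graphs $G$ and $H$ and $p\in[0,1]$, consider site percolation on $H$: each vertex of $H$ is open with probability $p$ and otherwise closed, independently for different vertices. An embedding of $G$ in the open set of $H$ is an injective map from the vertex set of $G$ to the set of open vertices of $H$ that maps neighbours in $G$ to neighbours in $H$. Let $$p_c(G,H):=\inf\bigl\{p\in[0,1]:\mathbb P(\text{there exists an embedding of } G \text{ in the open set of } H)>0\bigr\},$$ the infimum being taken in $[0,1]$ (so $\inf\emptyset=1$). For integers $d\ge 2$ and $M\ge 0$, let $\mathbb Z^d_{[M]}$ be the graph with vertex set $\mathbb Z^d$ in which $x,y$ are joined by an edge whenever $0<\|x-y\|_\infty\le M$. Let the comb graph $\mathbb K^d$ have vertex set $\mathbb Z^d$ and edges $(z,z+e_i)$ for all $z\in\mathbb Z^d$ and $1\le i\le d-1$, together with $(z,z+e_d)$ for all $z\in\mathbb Z^d$ with $z_1=0$, where $e_1,\dots,e_d$ are the standard basis vectors. Then for every $d\ge 2$, $$p_c\bigl(\mathbb K^d,\mathbb Z^d_{[M]}\bigr)\to 0\quad\text{as } M\to\infty .$$ -/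

import Mathlib

open MeasureTheory ProbabilityTheory Filter Topology unitInterval

/-- The spread-out lattice: vertex set `ℤ^d`, with `x` and `y` joined by an edge whenever
`0 < ‖x - y‖_∞ ≤ M` (the norm of `Fin d → ℤ` is the supremum norm). -/
def spreadOutLattice (d M : ℕ) : SimpleGraph (Fin d → ℤ) where
  Adj x y := 0 < ‖x - y‖ ∧ ‖x - y‖ ≤ (M : ℝ)
  symm := ⟨fun x y h => by rwa [norm_sub_rev y x]⟩
  loopless := ⟨fun x h => by simp at h⟩

/-- The `d`-dimensional comb graph (for `d ≥ 2`): vertex set `ℤ^d`, with edges `(z, z + e_i)` for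
every `z` and every direction `e_i` other than the last one, together with `(z, z + e_d)` for
those `z` whose first coordinate is `0`. Coordinates are numbered `0, …, d - 1` here, so the first
one has index `0` and the last one has index `d - 1`. -/
def combGraph (d : ℕ) : SimpleGraph (Fin d → ℤ) :=
  SimpleGraph.fromRel fun z w =>
    ∃ i : Fin d, w = z + Pi.single i 1 ∧
      ((i : ℕ) + 1 < d ∨ ∀ j : Fin d, (j : ℕ) = 0 → z j = 0)

/-- There is an embedding of `G` in the set `ω` of open vertices of `H`: an injective map from
the vertices of `G` to `ω` that maps neighbours in `G` to neighbours in `H`. -/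
def EmbedsInOpen {V W : Type*} (G : SimpleGraph V) (H : SimpleGraph W) (ω : Set W) : Prop :=
  ∃ f : V → W, Function.Injective f ∧ (∀ v, f v ∈ ω) ∧ ∀ u v, G.Adj u v → H.Adj (f u) (f v)

/-- The critical probability `p_c(G, H)`: the infimum of those `p ∈ [0, 1]` such that, with positive
probability, `G` embeds in the open set of site percolation on `H` with parameter `p`. The law
`setBer(Set.univ, p)` is that of the random set of vertices that contains each vertex with
probability `p`, independently for different vertices. The infimum is taken in `[0, 1]`, so that
it is `1` if there is no such `p`. -/
noncomputable def criticalProb {V W : Type*} (G : SimpleGraph V) (H : SimpleGraph W) : I :=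
  sInf {p : I | 0 < setBer(Set.univ, p) {ω : Set W | EmbedsInOpen G H ω}}

/-! Fix `p > 0` and cut `ℤ^d` into cubes of side `m`. A cube is closed if it has no open vertex;
closed cubes occur independently, with probability `(1 - p) ^ m ^ d`, which is small for large `m`.
Let `Q` be the set of closed cubes. It suffices to map the comb injectively into the complement of
`Q`, neighbours going to points at distance at most `2`, and then to pick an open vertex in each
cube; `M ≥ 3 * m` is enough.

The layers of the comb (last coordinate `k`) go to stacked 1-Lipschitz surfaces `F k` that avoid
`Q`. Consecutive surfaces may be far apart, but `F k = 2 * k` over any point of height `2 * k` in no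
cluster of `Q`-density at least `1/12`. A second surface `Φ`, with heights in the first coordinate,
avoids all points of such clusters. Shifting the first coordinate by `Φ` puts the hyperplane `z_1 =
0`, which carries the edges between layers, where every `F k` is flat.

The deterministic core is `IsTrail.extend`: what obstacles of density `1/A` push up is charged to a
cluster of density `1/(12 * A)`. Two uses give `144 = 12 * 12`. A count of clusters with
Borel–Cantelli (`measure_heavy_le`, `ae_heavy_bounded`) bounds the clusters of density `1/144` at
each point almost surely, so the surfaces are finite. -/

/-! ### Clusters of lattice points -/

/-- Two lattice points are near if they are at `ℓ^∞`-distance at most `1`. -/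
def Near {d : ℕ} (x y : Fin d → ℤ) : Prop := ∀ j, |x j - y j| ≤ 1

lemma Near.refl {d : ℕ} (x : Fin d → ℤ) : Near x x := fun j => by simp

lemma Near.symm {d : ℕ} {x y : Fin d → ℤ} (h : Near x y) : Near y x :=
  fun j => by rw [abs_sub_comm]; exact h j

/-- `Cluster n Y` says that `Y` is assembled from `n` points (with repetition) by successively
joining sets that come near each other. -/
inductive Cluster {d : ℕ} : ℕ → Finset (Fin d → ℤ) → Prop
  | single (z : Fin d → ℤ) : Cluster 1 {z}
  | union {m n : ℕ} {X Y : Finset (Fin d → ℤ)} {x y : Fin d → ℤ} :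
      Cluster m X → Cluster n Y → x ∈ X → y ∈ Y → Near x y → Cluster (m + n) (X ∪ Y)

lemma Cluster.pos {d n : ℕ} {Y : Finset (Fin d → ℤ)} (h : Cluster n Y) : 1 ≤ n := by
  induction h with
  | single => exact le_rfl
  | union => omega

lemma Cluster.sub_lt {d n : ℕ} {Y : Finset (Fin d → ℤ)} (h : Cluster n Y) (i : Fin d) :
    ∀ z ∈ Y, ∀ w ∈ Y, z i - w i < n := by
  induction h with
  | single z =>
    intro x hx y hy
    simp only [Finset.mem_singleton] at hx hy
    subst hx; subst hy; simp
  | @union m n X Y x y hX hY hx hy hxy ihX ihY =>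
    have h1 := abs_le.1 (hxy i)
    have := hX.pos
    have := hY.pos
    intro z hz w hw
    push_cast
    rcases Finset.mem_union.1 hz with hz | hz <;> rcases Finset.mem_union.1 hw with hw | hw
    · have := ihX z hz w hw; omega
    · have := ihX z hz x hx; have := ihY y hy w hw; omega
    · have := ihY z hz y hy; have := ihX x hx w hw; omega
    · have := ihY z hz w hw; omega

open Classical in
/-- The number of points of `Y` that belong to `Q`. -/
noncomputable def closedCount {d : ℕ} (Q : Set (Fin d → ℤ)) (Y : Finset (Fin d → ℤ)) : ℕ :=
  (Y.filter (· ∈ Q)).card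

lemma closedCount_mono {d : ℕ} (Q : Set (Fin d → ℤ)) {X Y : Finset (Fin d → ℤ)} (h : X ⊆ Y) :
    closedCount Q X ≤ closedCount Q Y := by
  classical
  exact Finset.card_le_card (Finset.filter_subset_filter _ h)

lemma closedCount_add_le {d : ℕ} (Q : Set (Fin d → ℤ)) {X Y Z : Finset (Fin d → ℤ)}
    (hXY : Disjoint X Y) (hX : X ⊆ Z) (hY : Y ⊆ Z) :
    closedCount Q X + closedCount Q Y ≤ closedCount Q Z := by
  classical
  unfold closedCount
  rw [← Finset.card_union_of_disjoint (Finset.disjoint_filter_filter hXY), ← Finset.filter_union]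
  exact Finset.card_le_card (Finset.filter_subset_filter _ (Finset.union_subset hX hY))

lemma closedCount_singleton {d : ℕ} {Q : Set (Fin d → ℤ)} {z : Fin d → ℤ} (hz : z ∈ Q) :
    closedCount Q {z} = 1 := by
  classical
  unfold closedCount
  rw [Finset.filter_singleton, if_pos hz, Finset.card_singleton]

/-- The point `z` lies in a cluster of size at least `r`, at least one `A`-th of which belongs
to `Q`. -/
def Heavy {d : ℕ} (Q : Set (Fin d → ℤ)) (A r : ℕ) (z : Fin d → ℤ) : Prop :=
  ∃ n Y, Cluster n Y ∧ z ∈ Y ∧ n ≤ A * closedCount Q Y ∧ r ≤ n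

lemma Heavy.mono {d : ℕ} {Q : Set (Fin d → ℤ)} {A B r : ℕ} {z : Fin d → ℤ} (h : A ≤ B)
    (hz : Heavy Q A r z) : Heavy Q B r z := by
  obtain ⟨n, Y, h1, h2, h3, h4⟩ := hz
  exact ⟨n, Y, h1, h2, h3.trans (Nat.mul_le_mul_right _ h), h4⟩

lemma heavy_of_mem {d : ℕ} {Q : Set (Fin d → ℤ)} {z : Fin d → ℤ} (hz : z ∈ Q) :
    Heavy Q 1 1 z :=
  ⟨1, {z}, .single z, by simp, by rw [closedCount_singleton hz], le_rfl⟩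

/-! ### Trails of clusters -/

/-- The union of the clusters in a list. -/
def trailSet {d : ℕ} : List (ℕ × Finset (Fin d → ℤ)) → Finset (Fin d → ℤ)
  | [] => ∅
  | c :: t => c.2 ∪ trailSet t

/-- The total size of the clusters in a list. -/
def trailSize {d : ℕ} : List (ℕ × Finset (Fin d → ℤ)) → ℕ
  | [] => 0
  | c :: t => c.1 + trailSize t

/-- The set `G` touches the first cluster of the list, or reaches down to height `2 * k` if the
list is empty. -/
def TrailLink {d : ℕ} (i : Fin d) (k : ℤ) (G : Finset (Fin d → ℤ)) :
    List (ℕ × Finset (Fin d → ℤ)) → Prop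
  | [] => ∃ w ∈ G, w i ≤ 2 * k
  | c :: _ => ∃ w ∈ G, ∃ v ∈ c.2, Near w v

/-- A list of successively touching clusters, the last one starting at height at most `2 * k`, in
which the heights reached at each stage are paid for by the points of `Q` visited so far. -/
def IsTrail {d : ℕ} (Q : Set (Fin d → ℤ)) (A : ℕ) (i : Fin d) (k : ℤ) :
    List (ℕ × Finset (Fin d → ℤ)) → Prop
  | [] => True
  | c :: t => IsTrail Q A i k t ∧ Cluster c.1 c.2 ∧ TrailLink i k c.2 t ∧
      ∀ w ∈ c.2, w i - 2 * k + 2 * c.1 + trailSize (c :: t) ≤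
        12 * A * (closedCount Q (trailSet (c :: t)) : ℤ)

section Trail

variable {d : ℕ} {Q : Set (Fin d → ℤ)} {A : ℕ} {i : Fin d} {k : ℤ}

lemma TrailLink.mono {G G' : Finset (Fin d → ℤ)} {L : List (ℕ × Finset (Fin d → ℤ))}
    (h : TrailLink i k G L) (hG : G ⊆ G') {k' : ℤ} (hk : k ≤ k') : TrailLink i k' G' L := by
  cases L with
  | nil => obtain ⟨w, hw, h⟩ := h; exact ⟨w, hG hw, by omega⟩
  | cons c t => obtain ⟨w, hw, h⟩ := h; exact ⟨w, hG hw, h⟩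

lemma IsTrail.mono {L : List (ℕ × Finset (Fin d → ℤ))} (h : IsTrail Q A i k L) {k' : ℤ}
    (hk : k ≤ k') : IsTrail Q A i k' L := by
  induction L with
  | nil => trivial
  | cons c t ih =>
    obtain ⟨h1, h2, h3, h4⟩ := h
    exact ⟨ih h1, h2, h3.mono subset_rfl hk, fun w hw => by have := h4 w hw; omega⟩

lemma IsTrail.cluster {c : ℕ × Finset (Fin d → ℤ)} {t : List (ℕ × Finset (Fin d → ℤ))}
    (h : IsTrail Q A i k (c :: t)) : Cluster (trailSize (c :: t)) (trailSet (c :: t)) := by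
  induction t generalizing c with
  | nil =>
    have := h.2.1
    simpa [trailSize, trailSet] using this
  | cons c' t ih =>
    obtain ⟨h1, h2, ⟨w, hw, v, hv, hwv⟩, -⟩ := h
    exact Cluster.union h2 (ih h1) hw (Finset.mem_union_left _ hv) hwv

lemma IsTrail.le_of_link {L : List (ℕ × Finset (Fin d → ℤ))} (h : IsTrail Q A i k L)
    {G : Finset (Fin d → ℤ)} {n : ℕ} (hG : Cluster n G) (hL : TrailLink i k G L) :
    ∀ w ∈ G, w i - 2 * k + trailSize L ≤ 12 * A * (closedCount Q (trailSet L) : ℤ) + n := by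
  intro w hw
  have hn := hG.pos
  cases L with
  | nil =>
    obtain ⟨u, hu, h⟩ := hL
    have := hG.sub_lt i w hw u hu
    have : (0 : ℤ) ≤ 12 * A * (closedCount Q (trailSet []) : ℤ) := by positivity
    simp only [trailSize, Nat.cast_zero]
    omega
  | cons c t =>
    obtain ⟨u, hu, v, hv, huv⟩ := hL
    have h1 := hG.sub_lt i w hw u hu
    have h2 := h.2.2.2 v hv
    have h3 := abs_le.1 (huv i)
    omega

/-- Loop erasure: the trail is cut back to its shortest suffix touching `G`, so no point of `Q` in
`G` was counted in what lies beyond the head of that suffix. A large head pays for `G` with its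
credit, the term `2 * c.1` of `IsTrail`; a small head is merged with `G`, whose own points of `Q`
then pay. -/
lemma IsTrail.extend {G : Finset (Fin d → ℤ)} {n : ℕ} (hG : Cluster n G)
    (hn : n ≤ A * closedCount Q G) {L L' : List (ℕ × Finset (Fin d → ℤ))}
    (hL : IsTrail Q A i k L) (hs : L' <:+ L) (hlink : TrailLink i k G L') :
    ∃ c t, IsTrail Q A i k (c :: t) ∧ G ⊆ c.2 := by
  have hn' : (n : ℤ) ≤ A * closedCount Q G := by exact_mod_cast hn
  have hn1 := hG.pos
  induction L generalizing L' with
  | nil =>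
    obtain rfl : L' = [] := by simpa using hs
    refine ⟨(n, G), [], ⟨trivial, hG, hlink, fun w hw => ?_⟩, subset_rfl⟩
    have h1 := hL.le_of_link hG hlink w hw
    have h2 : trailSet [((n, G) : ℕ × Finset (Fin d → ℤ))] = G := by simp [trailSet]
    have h3 : closedCount Q (∅ : Finset (Fin d → ℤ)) = 0 := by simp [closedCount]
    rw [h2]
    simp only [trailSize, trailSet, h3] at h1 ⊢
    push_cast at h1 ⊢
    linarith
  | cons c t ih =>
    obtain ⟨b, B⟩ := c
    by_cases hex : ∃ L'' , L'' <:+ t ∧ TrailLink i k G L''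
    · obtain ⟨L'', h1, h2⟩ := hex
      exact ih hL.1 h1 h2
    have hLL : L' = (b, B) :: t := by
      rcases List.suffix_cons_iff.1 hs with h | h
      · exact h
      · exact absurd ⟨L', h, hlink⟩ hex
    subst hLL
    -- Prepending `G` costs at most `4 * n`: `n` in height, `n` in total size and `2 * n` for the
    -- new credit. The old credit `2 * b` covers this.
    by_cases hb : 2 * n ≤ b
    · refine ⟨(n, G), (b, B) :: t, ⟨hL, hG, hlink, fun w hw => ?_⟩, subset_rfl⟩
      obtain ⟨u, hu, v, hv, huv⟩ := hlink
      have h1 := hG.sub_lt i w hw u hu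
      have h2 := hL.2.2.2 v hv
      have h3 := abs_le.1 (huv i)
      have h4 : (closedCount Q (trailSet ((b, B) :: t)) : ℤ) ≤
          closedCount Q (trailSet ((n, G) :: (b, B) :: t)) := by
        exact_mod_cast closedCount_mono Q Finset.subset_union_right
      have h5 : (12 * A * (closedCount Q (trailSet ((b, B) :: t)) : ℤ)) ≤
          12 * A * closedCount Q (trailSet ((n, G) :: (b, B) :: t)) := by gcongr
      simp only [trailSize] at h2 ⊢
      push_cast at h2 ⊢
      omega
    -- The merged cluster has size `b + n < 3 * n` and costs at most four times that, which is where
    -- `12` comes from.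
    · obtain ⟨u, hu, v, hv, huv⟩ := hlink
      have hBG : Cluster (b + n) (B ∪ G) := Cluster.union hL.2.1 hG hv hu huv.symm
      have hl : TrailLink i k (B ∪ G) t := hL.2.2.1.mono Finset.subset_union_left le_rfl
      refine ⟨(b + n, B ∪ G), t, ⟨hL.1, hBG, hl, fun w hw => ?_⟩, Finset.subset_union_right⟩
      have h1 := hL.1.le_of_link hBG hl w hw
      have hdis : Disjoint G (trailSet t) := by
        have key : ∀ s, s <:+ t → Disjoint G (trailSet s) := by
          intro s
          induction s with
          | nil => intro _; simp [trailSet]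
          | cons c s ihs =>
            intro hst
            rw [trailSet, Finset.disjoint_union_right]
            refine ⟨Finset.disjoint_left.2 fun x hx hx' => hex ⟨_, hst, x, hx, x, hx', .refl x⟩, ?_⟩
            exact ihs ((List.suffix_cons c s).trans hst)
        exact key t List.suffix_rfl
      have h2 : (closedCount Q G : ℤ) + closedCount Q (trailSet t) ≤
          closedCount Q (trailSet ((b + n, B ∪ G) :: t)) := by
        exact_mod_cast closedCount_add_le Q hdis
          (Finset.subset_union_right.trans Finset.subset_union_left) Finset.subset_union_right
      have h3 : 12 * A * ((closedCount Q G : ℤ) + closedCount Q (trailSet t)) ≤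
          12 * A * closedCount Q (trailSet ((b + n, B ∪ G) :: t)) := by gcongr
      simp only [trailSize] at h1 ⊢
      push_cast at h1 ⊢
      have h4 : (b : ℤ) < 2 * n := by omega
      nlinarith

/-- A singleton costs `3` in size and credit. The loss of relative height gives at least `1` and the
old credit at least `2`. Lifting a point by `1` while the base rises by `2` is such a loss, hence
the spacing `2 * k`. -/
lemma IsTrail.step {c : ℕ × Finset (Fin d → ℤ)} {t : List (ℕ × Finset (Fin d → ℤ))}
    (h : IsTrail Q A i k (c :: t)) {z z' : Fin d → ℤ} (hz : z ∈ c.2) (hzz : Near z z') {k' : ℤ}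
    (hk : k ≤ k') (hh : z' i - 2 * k' < z i - 2 * k) :
    IsTrail Q A i k' ((1, {z'}) :: c :: t) := by
  refine ⟨h.mono hk, .single z', ⟨z', by simp, z, hz, hzz.symm⟩, fun w hw => ?_⟩
  obtain rfl : w = z' := by simpa using hw
  have h1 := h.2.2.2 z hz
  have hb := h.2.1.pos
  have h5 : (12 * A * (closedCount Q (trailSet (c :: t)) : ℤ)) ≤
      12 * A * closedCount Q (trailSet ((1, {w}) :: c :: t)) := by
    have := closedCount_mono Q
      (Finset.subset_union_right : trailSet (c :: t) ⊆ ({w} : Finset _) ∪ trailSet (c :: t))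
    gcongr
    exact this
  simp only [trailSize] at h1 ⊢
  push_cast at h1 ⊢
  omega

end Trail

/-! ### Stacked Lipschitz surfaces -/

/-- The lattice points that lie below the `k`-th Lipschitz surface, with heights measured
in the `i`-th coordinate and obstacle set `T`: the smallest family containing all points of height
less than `2 * k` that leads to `1`-Lipschitz surfaces outside `T`, each one strictly above the
preceding one. -/
inductive Blocked {d : ℕ} (i : Fin d) (T : Set (Fin d → ℤ)) : ℤ → (Fin d → ℤ) → Prop
  | base {k : ℤ} {z : Fin d → ℤ} : z i < 2 * k → Blocked i T k z
  | obstacle {k : ℤ} {z : Fin d → ℤ} : z ∈ T → Blocked i T k (z - Pi.single i 1) → Blocked i T k z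
  | slope {k : ℤ} {z z' : Fin d → ℤ} : Blocked i T k z → Near z z' → z' i < z i → Blocked i T k z'
  | lift {k : ℤ} {z : Fin d → ℤ} : Blocked i T k z → Blocked i T (k + 1) (z + Pi.single i 1)

lemma near_add_single {d : ℕ} (i : Fin d) (z : Fin d → ℤ) : Near z (z + Pi.single i 1) := by
  intro j
  rcases eq_or_ne j i with rfl | h
  · simp
  · simp [h]

lemma near_sub_single {d : ℕ} (i : Fin d) (z : Fin d → ℤ) : Near z (z - Pi.single i 1) := by
  intro j
  rcases eq_or_ne j i with rfl | h
  · simp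
  · simp [h]

lemma Blocked.exists_trail {d : ℕ} {Q T : Set (Fin d → ℤ)} {A : ℕ} {i : Fin d}
    (hT : ∀ z ∈ T, Heavy Q A 1 z) {k : ℤ} {z : Fin d → ℤ} (h : Blocked i T k z) :
    z i < 2 * k ∨ ∃ c t, IsTrail Q A i k (c :: t) ∧ z ∈ c.2 := by
  induction h with
  | base h => exact .inl h
  | @obstacle k z hz _ ih =>
    obtain ⟨n, G, hG, hzG, hn, -⟩ := hT z hz
    have key : ∀ L, IsTrail Q A i k L → TrailLink i k G L →
        ∃ c t, IsTrail Q A i k (c :: t) ∧ z ∈ c.2 := by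
      intro L hL hl
      obtain ⟨c, t, h1, h2⟩ := hL.extend hG hn List.suffix_rfl hl
      exact ⟨c, t, h1, h2 hzG⟩
    rcases ih with ih | ⟨c, t, h1, h2⟩
    -- The point below `z` has height less than `2 * k`, so `z` itself may be at height exactly `2 *
    -- k`; `TrailLink` allows this.
    · refine .inr (key [] trivial ⟨z, hzG, ?_⟩)
      simp only [Pi.sub_apply, Pi.single_eq_same] at ih
      omega
    · exact .inr (key (c :: t) h1 ⟨z, hzG, _, h2, near_sub_single i z⟩)
  | @slope k z z' _ hzz hlt ih =>
    rcases ih with ih | ⟨c, t, h1, h2⟩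
    · exact .inl (hlt.trans ih)
    · exact .inr ⟨_, _, h1.step h2 hzz le_rfl (by omega), by simp⟩
  | @lift k z _ ih =>
    rcases ih with ih | ⟨c, t, h1, h2⟩
    · left; simp; omega
    · exact .inr ⟨_, _, h1.step h2 (near_add_single i z) (by omega : k ≤ k + 1)
        (by simp; omega), by simp⟩

lemma Cluster.extend_down {d n : ℕ} {Y : Finset (Fin d → ℤ)} (h : Cluster n Y) (i : Fin d)
    {z : Fin d → ℤ} (hz : z ∈ Y) (r : ℕ) :
    ∃ Y', Cluster (n + r) Y' ∧ Y ⊆ Y' ∧ Function.update z i (z i - r) ∈ Y' := by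
  induction r with
  | zero => exact ⟨Y, h, subset_rfl, by simpa using hz⟩
  | succ r ih =>
    obtain ⟨Y', h1, h2, h3⟩ := ih
    have hnear : Near (Function.update z i (z i - r))
        (Function.update z i (z i - (r + 1 : ℕ))) := by
      intro j
      rcases eq_or_ne j i with rfl | h
      · simp
      · simp [h]
    have hc := Cluster.union h1 (.single _) h3 (Finset.mem_singleton_self _) hnear
    rw [add_assoc] at hc
    exact ⟨_, hc, h2.trans Finset.subset_union_left, by simp⟩

/-- The trail inequality bounds size plus height, so a vertical segment of `r` points down to height
`2 * k` can be added to the trail at density `1/(12 * A)`. -/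
lemma Blocked.heavy {d : ℕ} {Q T : Set (Fin d → ℤ)} {A : ℕ} {i : Fin d}
    (hT : ∀ z ∈ T, Heavy Q A 1 z) {k : ℤ} {z : Fin d → ℤ} (h : Blocked i T k z) (r : ℕ)
    (hr : z i = 2 * k + r) : Heavy Q (12 * A) (r + 1) (Function.update z i (2 * k)) := by
  rcases h.exists_trail hT with h | ⟨c, t, h1, h2⟩
  · omega
  · have hc := h1.cluster
    obtain ⟨Y', hY, hsub, hmem⟩ :=
      hc.extend_down i (Finset.mem_union_left _ h2 : z ∈ trailSet (c :: t)) r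
    refine ⟨_, Y', hY, ?_, ?_, by have := hc.pos; omega⟩
    · rwa [show z i - r = 2 * k by omega] at hmem
    · have h3 := h1.2.2.2 z h2
      have h4 : 12 * A * closedCount Q (trailSet (c :: t)) ≤ 12 * A * closedCount Q Y' :=
        Nat.mul_le_mul_left _ (closedCount_mono Q hsub)
      zify at h4 ⊢
      omega

/-- Stacked Lipschitz surfaces outside of an obstacle set. -/
theorem exists_surfaces {d : ℕ} {Q T : Set (Fin d → ℤ)} {A : ℕ} (i : Fin d)
    (hT : ∀ z ∈ T, Heavy Q A 1 z) (hfin : ∀ z, ∃ r, ¬ Heavy Q (12 * A) r z) :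
    ∃ F : ℤ → (Fin d → ℤ) → ℤ,
      (∀ k x, Function.update x i (F k x) ∉ T) ∧
      (∀ k x y, (∀ j ≠ i, |x j - y j| ≤ 1) → F k y ≤ F k x + 1) ∧
      (∀ k x y, (∀ j ≠ i, x j = y j) → F k x = F k y) ∧
      (∀ x, StrictMono fun k => F k x) ∧
      (∀ k x, ¬ Heavy Q (12 * A) 1 (Function.update x i (2 * k)) → F k x = 2 * k) := by
  -- The surface is the least unblocked height in each column; each closure rule of `Blocked` then
  -- yields one of its properties.
  have hex : ∀ (k : ℤ) (x : Fin d → ℤ), ∃ f : ℤ, ¬ Blocked i T k (Function.update x i f) ∧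
      ∀ h, ¬ Blocked i T k (Function.update x i h) → f ≤ h := by
    intro k x
    refine Int.exists_least_of_bdd ⟨2 * k, fun h hh => ?_⟩ ?_
    · by_contra hlt
      exact hh (.base (by simpa using hlt))
    · obtain ⟨r, hr⟩ := hfin (Function.update x i (2 * k))
      refine ⟨2 * k + r, fun hb => hr ?_⟩
      obtain ⟨n, Y, h1, h2, h3, h4⟩ := hb.heavy hT r (by simp)
      exact ⟨n, Y, h1, by simpa using h2, h3, by omega⟩
  choose F hF hmin using hex
  refine ⟨F, fun k x hx => ?_, fun k x y hxy => ?_, fun k x y hxy => ?_, fun x => ?_,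
    fun k x hx => ?_⟩
  · refine hF k x (.obstacle hx ?_)
    by_contra hb
    have h1 : Function.update x i (F k x) - Pi.single i 1 = Function.update x i (F k x - 1) := by
      ext j
      rcases eq_or_ne j i with rfl | h
      · simp
      · simp [h]
    rw [h1] at hb
    have := hmin k x _ hb
    omega
  · refine hmin k y _ fun hb => hF k x (.slope hb (fun j => ?_) (by simp))
    rcases eq_or_ne j i with rfl | h
    · simp
    · simpa [h, abs_sub_comm] using hxy j h
  · have h1 : ∀ h, Function.update x i h = Function.update y i h := by
      intro h
      ext j
      rcases eq_or_ne j i with rfl | hj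
      · simp
      · simpa [hj] using hxy j hj
    refine le_antisymm (hmin k x _ ?_) (hmin k y _ ?_)
    · rw [h1]; exact hF k y
    · rw [← h1]; exact hF k x
  · refine strictMono_int_of_lt_succ fun k => ?_
    have h1 : F k x ≤ F (k + 1) x - 1 := by
      refine hmin k x _ fun hb => hF (k + 1) x ?_
      convert hb.lift using 1
      ext j
      rcases eq_or_ne j i with rfl | hj
      · simp
      · simp [hj]
    show F k x < F (k + 1) x
    omega
  · refine le_antisymm (hmin k x _ fun hb => hx ?_) ?_
    · simpa using hb.heavy hT 0 (by simp)
    · by_contra hlt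
      exact hF k x (.base (by simpa using hlt))

/-! ### A coarse embedding of the comb graph -/

/-- If heavy clusters are locally bounded in size, then the comb graph maps injectively to the
complement of `Q`, with neighbours being mapped to points at distance at most `2`. -/
theorem exists_comb_map {d : ℕ} (hd : 2 ≤ d) {Q : Set (Fin d → ℤ)}
    (hfin : ∀ z, ∃ r, ¬ Heavy Q 144 r z) :
    ∃ ψ : (Fin d → ℤ) → (Fin d → ℤ), Function.Injective ψ ∧ (∀ z, ψ z ∉ Q) ∧
      ∀ z w, (combGraph d).Adj z w → ∀ j, |ψ z j - ψ w j| ≤ 2 := by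
  let a : Fin d := ⟨0, by omega⟩
  let b : Fin d := ⟨d - 1, by omega⟩
  have hab : a ≠ b := by simp only [a, b, ne_eq, Fin.mk.injEq]; omega
  have hfin' : ∀ z, ∃ r, ¬ Heavy Q (12 * 1) r z := fun z =>
    (hfin z).imp fun r hr h => hr (h.mono (by norm_num))
  obtain ⟨F, hFQ, hFlip, hFcongr, hFmono, hFeq⟩ :=
    exists_surfaces b (fun z hz => heavy_of_mem hz : ∀ z ∈ Q, Heavy Q 1 1 z) hfin'
  obtain ⟨G, hGQ, hGlip, hGcongr, -, -⟩ :=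
    exists_surfaces (Q := Q) (T := {z | Heavy Q 12 1 z}) (A := 12) a (fun z hz => hz) hfin
  set Φ : (Fin d → ℤ) → ℤ := G 0 with hΦ
  let p : (Fin d → ℤ) → (Fin d → ℤ) := fun z => Function.update z b (2 * z b)
  let x : (Fin d → ℤ) → (Fin d → ℤ) := fun z => Function.update (p z) a (z a + Φ (p z))
  let ψ : (Fin d → ℤ) → (Fin d → ℤ) := fun z => Function.update (x z) b (F (z b) (x z))
  have ψb : ∀ z, ψ z b = F (z b) (x z) := fun z => by simp [ψ]
  have ψa : ∀ z, ψ z a = z a + Φ (p z) := fun z => by simp [ψ, x, hab]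
  have ψj : ∀ z j, j ≠ a → j ≠ b → ψ z j = z j := fun z j h1 h2 => by simp [ψ, x, p, h1, h2]
  have xa : ∀ z, x z a = z a + Φ (p z) := fun z => by simp [x]
  have xj : ∀ z j, j ≠ a → j ≠ b → x z j = z j := fun z j h1 h2 => by simp [x, p, h1, h2]
  have pb : ∀ z, p z b = 2 * z b := fun z => by simp [p]
  have pj : ∀ z j, j ≠ b → p z j = z j := fun z j h => by simp [p, h]
  have hadj : ∀ (z : Fin d → ℤ) (i : Fin d),
      ((i : ℕ) + 1 < d ∨ ∀ j : Fin d, (j : ℕ) = 0 → z j = 0) →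
      ∀ j, |ψ z j - ψ (z + Pi.single i 1) j| ≤ 2 := by
    intro z i hi
    set w := z + Pi.single i 1 with hw
    have wi : w i = z i + 1 := by simp [hw]
    have wj : ∀ j, j ≠ i → w j = z j := fun j h => by simp [hw, h]
    by_cases hib : i = b
    · subst hib
      have hza : z a = 0 := by
        rcases hi with hi | hi
        · simp only [b] at hi; omega
        · exact hi a rfl
      have hwa : w a = 0 := by rw [wj a hab, hza]
      have hΦ2 : ∀ u v : Fin d → ℤ, (∀ j, j ≠ a → j ≠ b → u j = v j) → |u b - v b| ≤ 2 →
          Φ u ≤ Φ v + 2 := by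
        intro u v huv hb
        -- A midpoint splits a displacement of `2` into two Lipschitz steps.
        set t : Fin d → ℤ := Function.update u b ((u b + v b) / 2) with ht
        have h1 := hGlip 0 t u fun j hj => by
          rcases eq_or_ne j b with rfl | hjb
          · simp only [ht, Function.update_self]; rw [abs_le] at hb ⊢; omega
          · simp [ht, hjb]
        have h2 := hGlip 0 v t fun j hj => by
          rcases eq_or_ne j b with rfl | hjb
          · simp only [ht, Function.update_self]; rw [abs_le] at hb ⊢; omega
          · simp [ht, hjb, huv j hj hjb]
        simp only [hΦ]
        omega
      -- When `u a = 0`, the point of height `2 * u b` over `x u` lies on the surface `Φ`, hence is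
      -- not heavy.
      have hFv : ∀ u : Fin d → ℤ, u a = 0 → F (u b) (x u) = 2 * u b := by
        intro u hu
        refine hFeq _ _ ?_
        have h1 : Function.update (x u) b (2 * u b) = Function.update (p u) a (Φ (p u)) := by
          ext j
          rcases eq_or_ne j b with rfl | hjb
          · simp [hab.symm, pb]
          · rcases eq_or_ne j a with rfl | hja
            · simp [hab, xa, hu]
            · simp [hjb, hja, xj, pj]
        rw [h1]
        exact hGQ 0 (p u)
      intro j
      rcases eq_or_ne j b with rfl | hjb
      · rw [ψb, ψb, hFv z hza, hFv w hwa, wi, abs_le]; omega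
      · rcases eq_or_ne j a with rfl | hja
        · rw [ψa, ψa, hza, hwa]
          have h1 := hΦ2 (p z) (p w)
            (fun j hja hjb => by rw [pj _ _ hjb, pj _ _ hjb, wj _ hjb])
            (by rw [pb, pb, wi, abs_le]; omega)
          have h2 := hΦ2 (p w) (p z)
            (fun j hja hjb => by rw [pj _ _ hjb, pj _ _ hjb, wj _ hjb])
            (by rw [pb, pb, wi, abs_le]; omega)
          rw [abs_le]; omega
        · rw [ψj _ _ hja hjb, ψj _ _ hja hjb, wj _ hjb]; simp
    · have hzb : w b = z b := wj b (Ne.symm hib)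
      have hxa : |x z a - x w a| ≤ 1 := by
        rw [xa, xa, abs_le]
        by_cases hia : i = a
        · subst hia
          have h1 : Φ (p z) = Φ (p w) := hGcongr 0 _ _ fun j hj => by
            rcases eq_or_ne j b with rfl | hjb
            · rw [pb, pb, hzb]
            · rw [pj _ _ hjb, pj _ _ hjb, wj _ hj]
          rw [h1, wi]; omega
        · have hp : ∀ j, |p z j - p w j| ≤ 1 := by
            intro j
            rcases eq_or_ne j b with rfl | hjb
            · rw [pb, pb, hzb]; simp
            · rw [pj _ _ hjb, pj _ _ hjb]
              rcases eq_or_ne j i with rfl | hji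
              · rw [wi]; simp
              · rw [wj _ hji]; simp
          have h1 := hGlip 0 (p z) (p w) fun j _ => hp j
          have h2 := hGlip 0 (p w) (p z) fun j _ => by rw [abs_sub_comm]; exact hp j
          rw [wj a (Ne.symm hia)]
          simp only [hΦ]
          omega
      have hx : ∀ j ≠ b, |x z j - x w j| ≤ 1 := by
        intro j hjb
        rcases eq_or_ne j a with rfl | hja
        · exact hxa
        · rw [xj _ _ hja hjb, xj _ _ hja hjb]
          rcases eq_or_ne j i with rfl | hji
          · rw [wi]; simp
          · rw [wj _ hji]; simp
      intro j
      rcases eq_or_ne j b with rfl | hjb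
      · have h1 := hFlip (z b) (x z) (x w) hx
        have h2 := hFlip (z b) (x w) (x z) fun j hj => by rw [abs_sub_comm]; exact hx j hj
        rw [ψb, ψb, hzb, abs_le]; omega
      · have h1 := hx j hjb
        have h2 : ∀ u, ψ u j = x u j := fun u => by simp [ψ, hjb]
        rw [h2, h2]
        exact h1.trans (by norm_num)
  -- Injectivity: strict monotonicity of the stack recovers the layer, and then `Φ`, independent of
  -- the first coordinate, can be subtracted.
  refine ⟨ψ, fun z w hzw => ?_, fun z => hFQ _ _, fun z w hzw => ?_⟩
  · have hx : ∀ j ≠ b, x z j = x w j := fun j hj => by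
      have h1 := congrFun hzw j
      simpa [ψ, hj] using h1
    have hb : z b = w b := by
      have h1 := congrFun hzw b
      rw [ψb, ψb, hFcongr (z b) _ _ hx] at h1
      exact (hFmono (x w)).injective h1
    have hp : ∀ j ≠ a, p z j = p w j := by
      intro j hja
      rcases eq_or_ne j b with rfl | hjb
      · rw [pb, pb, hb]
      · rw [pj _ _ hjb, pj _ _ hjb, ← xj z j hja hjb, ← xj w j hja hjb, hx j hjb]
    ext j
    rcases eq_or_ne j b with rfl | hjb
    · exact hb
    · rcases eq_or_ne j a with rfl | hja
      · have h1 := hx a hab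
        rw [xa, xa, show Φ (p z) = Φ (p w) from hGcongr 0 _ _ hp] at h1
        omega
      · rw [← xj z j hja hjb, ← xj w j hja hjb, hx j hjb]
  · obtain ⟨-, ⟨i, rfl, hi⟩ | ⟨i, rfl, hi⟩⟩ := hzw
    · exact hadj z i hi
    · intro j
      rw [abs_sub_comm]
      exact hadj w i hi j

/-! ### Blocks -/

/-- The cube of side `m` with lower corner `m • z`. -/
noncomputable def block {d : ℕ} (m : ℕ) (z : Fin d → ℤ) : Finset (Fin d → ℤ) :=
  Fintype.piFinset fun j => Finset.Ico (m * z j) (m * z j + m)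

lemma mem_block {d m : ℕ} {z v : Fin d → ℤ} :
    v ∈ block m z ↔ ∀ j, m * z j ≤ v j ∧ v j < m * z j + m := by
  simp [block]

lemma card_block {d m : ℕ} (z : Fin d → ℤ) : (block m z).card = m ^ d := by
  simp [block]

lemma eq_of_mem_block {d m : ℕ} {z w v : Fin d → ℤ} (hz : v ∈ block m z)
    (hw : v ∈ block m w) : z = w := by
  ext j
  have h1 := mem_block.1 hz j
  have h2 := mem_block.1 hw j
  have hm : (0 : ℤ) < m := by omega
  have h3 : z j < w j + 1 := by
    by_contra h
    have : (m : ℤ) * (w j + 1) ≤ m * z j := mul_le_mul_of_nonneg_left (by omega) hm.le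
    linarith
  have h4 : w j < z j + 1 := by
    by_contra h
    have : (m : ℤ) * (z j + 1) ≤ m * w j := mul_le_mul_of_nonneg_left (by omega) hm.le
    linarith
  omega

/-- The blocks of side `m` that do not meet `ω`. -/
def closedBlocks {d : ℕ} (m : ℕ) (ω : Set (Fin d → ℤ)) : Set (Fin d → ℤ) :=
  {z | ∀ v ∈ block m z, v ∉ ω}

theorem embedsInOpen_of_heavy_bounded {d m M : ℕ} (hd : 2 ≤ d) (hM : 3 * m ≤ M)
    {ω : Set (Fin d → ℤ)} (hfin : ∀ z, ∃ r, ¬ Heavy (closedBlocks m ω) 144 r z) :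
    EmbedsInOpen (combGraph d) (spreadOutLattice d M) ω := by
  obtain ⟨ψ, hinj, hopen, hadj⟩ := exists_comb_map hd hfin
  have hex : ∀ z, ∃ v ∈ block m (ψ z), v ∈ ω := fun z => by
    have h := hopen z
    simpa [closedBlocks] using h
  choose f hf hfω using hex
  have finj : Function.Injective f := fun z w h =>
    hinj (eq_of_mem_block (hf z) (h ▸ hf w))
  refine ⟨f, finj, hfω, fun z w hzw => ⟨?_, ?_⟩⟩
  · rw [norm_pos_iff, sub_ne_zero]
    exact finj.ne hzw.ne
  · refine (pi_norm_le_iff_of_nonneg (Nat.cast_nonneg M)).2 fun j => ?_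
    have h1 := abs_le.1 (hadj z w hzw j)
    have h2 := mem_block.1 (hf z) j
    have h3 := mem_block.1 (hf w) j
    have hm : (0 : ℤ) ≤ m := Int.natCast_nonneg m
    have h4 : (m : ℤ) * (ψ z j - ψ w j) ≤ m * 2 := mul_le_mul_of_nonneg_left h1.2 hm
    have h5 : (m : ℤ) * (-2) ≤ m * (ψ z j - ψ w j) := mul_le_mul_of_nonneg_left h1.1 hm
    have h6 : |f z j - f w j| ≤ (M : ℤ) := by
      rw [abs_le]
      zify at hM
      constructor <;> linarith
    rw [Pi.sub_apply, Int.norm_eq_abs]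
    exact_mod_cast h6

/-! ### Counting clusters -/

/-- The graph joining distinct lattice points that are near each other. -/
def nearGraph (d : ℕ) : SimpleGraph (Fin d → ℤ) where
  Adj x y := x ≠ y ∧ Near x y
  symm := ⟨fun _ _ h => ⟨h.1.symm, h.2.symm⟩⟩
  loopless := ⟨fun _ h => h.1 rfl⟩

/-- Closed walks around two clusters are joined by crossing the edge between them back and forth.
This reduces counting clusters to counting walks. -/
lemma Cluster.exists_closed_walk {d n : ℕ} {Y : Finset (Fin d → ℤ)} (h : Cluster n Y) :
    ∀ z ∈ Y, ∃ c : (nearGraph d).Walk z z, c.length + 2 ≤ 2 * n ∧ ∀ v, v ∈ c.support ↔ v ∈ Y := by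
  induction h with
  | single z =>
    intro w hw
    obtain rfl : w = z := by simpa using hw
    exact ⟨.nil, by simp, by simp⟩
  | @union m n X Y x y hX hY hx hy hxy ihX ihY =>
    have key : ∃ c : (nearGraph d).Walk x x, c.length + 2 ≤ 2 * (m + n) ∧
        ∀ v, v ∈ c.support ↔ v ∈ X ∪ Y := by
      obtain ⟨c, hc, hcX⟩ := ihX x hx
      obtain ⟨e, he, heY⟩ := ihY y hy
      by_cases hne : x = y
      · subst hne
        refine ⟨c.append e, by rw [SimpleGraph.Walk.length_append]; omega, fun v => ?_⟩
        rw [SimpleGraph.Walk.mem_support_append_iff, hcX, heY, Finset.mem_union]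
      · have hadj : (nearGraph d).Adj x y := ⟨hne, hxy⟩
        refine ⟨c.append (.cons hadj (e.append (.cons hadj.symm .nil))), ?_, fun v => ?_⟩
        · simp only [SimpleGraph.Walk.length_append, SimpleGraph.Walk.length_cons,
            SimpleGraph.Walk.length_nil]
          omega
        · simp only [SimpleGraph.Walk.mem_support_append_iff, SimpleGraph.Walk.support_cons,
            SimpleGraph.Walk.support_nil, List.mem_cons, hcX, heY, Finset.mem_union,
            List.not_mem_nil, or_false]
          constructor
          · rintro (h | rfl | h | rfl | rfl) <;> simp_all
          · rintro (h | h) <;> simp_all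
    obtain ⟨c, hc, hcS⟩ := key
    intro z hz
    have hzc := (hcS z).2 hz
    refine ⟨c.rotate z hzc, by rw [SimpleGraph.Walk.length_rotate]; exact hc, fun v => ?_⟩
    rw [SimpleGraph.Walk.mem_support_rotate_iff, hcS]

/-- A family of finite sets containing the ranges of all walks of length at most `n` from `z`. -/
noncomputable def walkRanges {d : ℕ} : ℕ → (Fin d → ℤ) → Finset (Finset (Fin d → ℤ))
  | 0, z => {{z}}
  | n + 1, z => (Fintype.piFinset fun _ : Fin d => Finset.Icc (-1 : ℤ) 1).biUnion fun u =>
      (walkRanges n (z + u)).image (insert z)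

lemma card_walkRanges_le {d : ℕ} (n : ℕ) (z : Fin d → ℤ) :
    (walkRanges n z).card ≤ (3 ^ d) ^ n := by
  induction n generalizing z with
  | zero => simp [walkRanges]
  | succ n ih =>
    rw [walkRanges, pow_succ']
    refine (Finset.card_biUnion_le_card_mul _ _ ((3 ^ d) ^ n) fun u _ =>
      Finset.card_image_le.trans (ih _)).trans ?_
    simp

lemma card_le_of_mem_walkRanges {d : ℕ} (n : ℕ) (z : Fin d → ℤ) :
    ∀ Y ∈ walkRanges n z, Y.card ≤ n + 1 := by
  induction n generalizing z with
  | zero => simp [walkRanges]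
  | succ n ih =>
    intro Y hY
    simp only [walkRanges, Finset.mem_biUnion, Finset.mem_image] at hY
    obtain ⟨u, -, X, hX, rfl⟩ := hY
    exact (Finset.card_insert_le _ _).trans (Nat.succ_le_succ (ih _ X hX))

lemma support_mem_walkRanges {d : ℕ} (n : ℕ) {z w : Fin d → ℤ} (c : (nearGraph d).Walk z w)
    (hc : c.length ≤ n) : c.support.toFinset ∈ walkRanges n z := by
  induction n generalizing z with
  | zero =>
    cases c with
    | nil => simp [walkRanges]
    | cons h c => simp at hc
  | succ n ih =>
    simp only [walkRanges, Finset.mem_biUnion, Finset.mem_image]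
    cases c with
    | nil =>
      -- Null steps let shorter walks be padded.
      refine ⟨0, by simp, {w}, ?_, by simp⟩
      have := ih (.nil : (nearGraph d).Walk w w) (by simp)
      simpa using this
    | @cons _ v _ h c =>
      refine ⟨v - z, ?_, c.support.toFinset, ?_, by simp⟩
      · simp only [Fintype.mem_piFinset, Finset.mem_Icc, Pi.sub_apply]
        intro j
        have := abs_le.1 (h.2 j)
        omega
      · rw [add_sub_cancel]
        exact ih c (by simpa using hc)

lemma Cluster.mem_walkRanges {d n : ℕ} {Y : Finset (Fin d → ℤ)} (h : Cluster n Y)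
    {z : Fin d → ℤ} (hz : z ∈ Y) : Y ∈ walkRanges (2 * n) z := by
  obtain ⟨c, hc, hcY⟩ := h.exists_closed_walk z hz
  have h1 : c.support.toFinset = Y := by ext v; simp [hcY]
  rw [← h1]
  exact support_mem_walkRanges _ c (by omega)

/-! ### Heavy clusters of closed blocks are rare -/

open scoped ENNReal

lemma setBernoulli_disjoint {V : Type*} (p : I) (S : Finset V) :
    setBer(Set.univ, p) {ω : Set V | ∀ v ∈ S, v ∉ ω} = (toNNReal (σ p) : ℝ≥0∞) ^ S.card := by
  rw [setBernoulli_apply']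
  have h1 : (fun q : V → Prop => {i | q i}) ⁻¹' {ω : Set V | ∀ v ∈ S, v ∉ ω} =
      Set.pi (S : Set V) fun _ => {False} := by
    ext q
    simp [Set.mem_pi]
  rw [h1, Measure.infinitePi_pi _ (fun _ _ => MeasurableSet.of_discrete)]
  simp

lemma measure_closedBlocks {d m : ℕ} (p : I) (C : Finset (Fin d → ℤ)) :
    setBer(Set.univ, p) {ω : Set (Fin d → ℤ) | ∀ z ∈ C, z ∈ closedBlocks m ω} =
      ((toNNReal (σ p) : ℝ≥0∞) ^ m ^ d) ^ C.card := by
  have h1 : {ω : Set (Fin d → ℤ) | ∀ z ∈ C, z ∈ closedBlocks m ω} =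
      {ω | ∀ v ∈ C.biUnion (block m), v ∉ ω} := by
    ext ω
    simp only [closedBlocks, Set.mem_ofPred_eq, Finset.mem_biUnion]
    exact ⟨fun h v ⟨z, hz, hv⟩ => h z hz v hv, fun h z hz v hv => h v ⟨z, hz, hv⟩⟩
  rw [h1, setBernoulli_disjoint, Finset.card_biUnion, Finset.sum_congr rfl fun z _ => card_block z,
    Finset.sum_const, smul_eq_mul, mul_comm, pow_mul]
  intro z _ w _ hzw
  exact Finset.disjoint_left.2 fun v hz hw => hzw (eq_of_mem_block hz hw)

/-- Union bound: at most `(3 ^ d) ^ (2 * n)` clusters, at most `2 ^ (2 * n + 1)` choices of the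
closed subset, and probability at most `r ^ n` for each. -/
lemma measure_heavy_le {d m A : ℕ} {p : I} {r : ℝ≥0∞} (hr : r ≤ 1)
    (hp : (toNNReal (σ p) : ℝ≥0∞) ^ m ^ d ≤ r ^ A) (z : Fin d → ℤ) (n : ℕ) :
    setBer(Set.univ, p) {ω | ∃ Y, Cluster n Y ∧ z ∈ Y ∧
      n ≤ A * closedCount (closedBlocks m ω) Y} ≤ 2 * (4 * (3 ^ d) ^ 2 * r) ^ n := by
  classical
  have hsub : {ω | ∃ Y, Cluster n Y ∧ z ∈ Y ∧ n ≤ A * closedCount (closedBlocks m ω) Y} ⊆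
      ⋃ Y ∈ walkRanges (2 * n) z, ⋃ C ∈ Y.powerset.filter fun C => n ≤ A * C.card,
        {ω : Set (Fin d → ℤ) | ∀ z ∈ C, z ∈ closedBlocks m ω} := by
    rintro ω ⟨Y, hY, hz, hn⟩
    simp only [Set.mem_iUnion]
    refine ⟨Y, hY.mem_walkRanges hz, Y.filter (· ∈ closedBlocks m ω), ?_, ?_⟩
    · rw [Finset.mem_filter, Finset.mem_powerset]
      refine ⟨Finset.filter_subset _ _, ?_⟩
      convert hn using 2
      unfold closedCount
      congr
    · intro w hw
      exact (Finset.mem_filter.1 hw).2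
  have hC : ∀ C : Finset (Fin d → ℤ), n ≤ A * C.card →
      setBer(Set.univ, p) {ω : Set (Fin d → ℤ) | ∀ z ∈ C, z ∈ closedBlocks m ω} ≤ r ^ n := by
    intro C hn
    rw [measure_closedBlocks]
    calc ((toNNReal (σ p) : ℝ≥0∞) ^ m ^ d) ^ C.card ≤ (r ^ A) ^ C.card := by gcongr
      _ = r ^ (A * C.card) := by rw [pow_mul]
      _ ≤ r ^ n := pow_le_pow_right_of_le_one' hr hn
  calc _ ≤ ∑ Y ∈ walkRanges (2 * n) z, ∑ C ∈ Y.powerset.filter fun C => n ≤ A * C.card, r ^ n := by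
        refine (measure_mono hsub).trans ((measure_biUnion_finset_le _ _).trans ?_)
        refine Finset.sum_le_sum fun Y _ => (measure_biUnion_finset_le _ _).trans ?_
        exact Finset.sum_le_sum fun C hCm => hC C (Finset.mem_filter.1 hCm).2
    _ ≤ ∑ Y ∈ walkRanges (2 * n) z, (2 : ℝ≥0∞) ^ (2 * n + 1) * r ^ n := by
        refine Finset.sum_le_sum fun Y hY => ?_
        rw [Finset.sum_const, nsmul_eq_mul]
        gcongr
        have h1 : (Y.powerset.filter fun C => n ≤ A * C.card).card ≤ 2 ^ (2 * n + 1) :=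
          (Finset.card_filter_le _ _).trans (by
            rw [Finset.card_powerset]
            exact Nat.pow_le_pow_right (by norm_num) (card_le_of_mem_walkRanges _ _ Y hY))
        exact_mod_cast h1
    _ ≤ (3 ^ d) ^ (2 * n) * ((2 : ℝ≥0∞) ^ (2 * n + 1) * r ^ n) := by
        rw [Finset.sum_const, nsmul_eq_mul]
        gcongr
        exact_mod_cast card_walkRanges_le (2 * n) z
    _ = 2 * (4 * (3 ^ d) ^ 2 * r) ^ n := by
        rw [mul_pow, mul_pow, pow_succ, pow_mul, pow_mul]
        norm_num
        ring

theorem ae_heavy_bounded {d m A : ℕ} {p : I} {r : ℝ≥0∞} (hr : r ≤ 1)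
    (hr' : 4 * (3 ^ d) ^ 2 * r < 1) (hp : (toNNReal (σ p) : ℝ≥0∞) ^ m ^ d ≤ r ^ A) :
    ∀ᵐ ω ∂setBer((Set.univ : Set (Fin d → ℤ)), p),
      ∀ z, ∃ s, ¬ Heavy (closedBlocks m ω) A s z := by
  rw [ae_all_iff]
  intro z
  have hsum : ∑' n, setBer(Set.univ, p) {ω | ∃ Y, Cluster n Y ∧ z ∈ Y ∧
      n ≤ A * closedCount (closedBlocks m ω) Y} ≠ ∞ := by
    refine ne_top_of_le_ne_top ?_ (ENNReal.tsum_le_tsum fun n => measure_heavy_le hr hp z n)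
    rw [ENNReal.tsum_mul_left, ENNReal.tsum_geometric]
    refine ENNReal.mul_ne_top (by norm_num) (ENNReal.inv_ne_top.2 ?_)
    exact (tsub_pos_of_lt hr').ne'
  filter_upwards [ae_eventually_notMem hsum] with ω hω
  obtain ⟨s, hs⟩ := eventually_atTop.1 hω
  refine ⟨s, fun ⟨n, Y, h1, h2, h3, h4⟩ => hs n h4 ⟨Y, h1, h2, h3⟩⟩

lemma exists_block_size (d : ℕ) (hd : 2 ≤ d) {p : I} (hp : 0 < p) (A : ℕ) {r : ℝ≥0∞}
    (hr : 0 < r) : ∃ m : ℕ, (toNNReal (σ p) : ℝ≥0∞) ^ m ^ d ≤ r ^ A := by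
  have hlt : (toNNReal (σ p) : ℝ≥0∞) < 1 := by
    have h1 : toNNReal (σ p) < 1 := by
      rw [← NNReal.coe_lt_coe]
      have : (0 : ℝ) < p := hp
      simpa using this
    exact_mod_cast h1
  have h2 := ENNReal.tendsto_pow_atTop_nhds_zero_of_lt_one hlt
  have h3 : (0 : ℝ≥0∞) < r ^ A := ENNReal.pow_pos hr A
  obtain ⟨m, hm⟩ := (h2.eventually (gt_mem_nhds h3)).exists
  exact ⟨m, (pow_le_pow_right_of_le_one' hlt.le (Nat.le_self_pow (by omega) m)).trans hm.le⟩

theorem eventually_criticalProb_le (d : ℕ) (hd : 2 ≤ d) {p : I} (hp : 0 < p) :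
    ∀ᶠ M : ℕ in atTop, criticalProb (combGraph d) (spreadOutLattice d M) ≤ p := by
  -- This makes the ratio of the geometric series `1/2`.
  let r : ℝ≥0∞ := (4 * (3 ^ d) ^ 2 * 2)⁻¹
  have hK : (4 * (3 ^ d) ^ 2 : ℝ≥0∞) ≠ 0 := by positivity
  have hK' : (4 * (3 ^ d) ^ 2 : ℝ≥0∞) ≠ ∞ := by finiteness
  have hr0 : 0 < r := ENNReal.inv_pos.2 (by finiteness)
  have hr' : 4 * (3 ^ d) ^ 2 * r < 1 := by
    simp only [r]
    rw [ENNReal.mul_inv (.inl hK) (.inl hK'), ← mul_assoc, ENNReal.mul_inv_cancel hK hK', one_mul]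
    exact ENNReal.inv_lt_one.2 (by norm_num)
  have hr : r ≤ 1 := by
    refine le_trans ?_ hr'.le
    refine le_mul_of_one_le_left' ?_
    exact_mod_cast Nat.one_le_iff_ne_zero.2 (by positivity : 4 * (3 ^ d) ^ 2 ≠ 0)
  obtain ⟨m, hm⟩ := exists_block_size d hd hp 144 hr0
  filter_upwards [eventually_ge_atTop (3 * m)] with M hM
  refine sInf_le ?_
  have hae : {ω | EmbedsInOpen (combGraph d) (spreadOutLattice d M) ω} =ᵐ[setBer(Set.univ, p)]
      (Set.univ : Set (Set (Fin d → ℤ))) := by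
    rw [eventuallyEq_univ]
    filter_upwards [ae_heavy_bounded hr hr' hm] with ω hω
    exact embedsInOpen_of_heavy_bounded hd hM hω
  show 0 < setBer(Set.univ, p) {ω | EmbedsInOpen (combGraph d) (spreadOutLattice d M) ω}
  rw [measure_congr hae, measure_univ]
  exact one_pos

theorem corollary2 (d : ℕ) (hd : 2 ≤ d) :
    Tendsto (fun M : ℕ => (criticalProb (combGraph d) (spreadOutLattice d M) : ℝ))
      atTop (𝓝 0) := by
  refine tendsto_order.2 ⟨fun a ha => .of_forall fun M => ha.trans_le (unitInterval.nonneg _),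
    fun a ha => ?_⟩
  let p : I := ⟨min (a / 2) 1, by positivity, min_le_right _ _⟩
  have hp : 0 < p := by
    show (0 : ℝ) < min (a / 2) 1
    positivity
  filter_upwards [eventually_criticalProb_le d hd hp] with M hM
  have h1 : (criticalProb (combGraph d) (spreadOutLattice d M) : ℝ) ≤ min (a / 2) 1 := hM
  have h2 := min_le_left (a / 2) 1
  linarith
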